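/- A left brace is a set $B$ with an abelian group structure $(B,+)$ and a group structure $(B,\cdot)$ such that $a\cdot(b+c)+a=a\cdot b+a\cdot c$; put $\lambda_a(b)=a\cdot b-a$. An ideal is a normal subgroup of $(B,\cdot)$ stable under all $\lambda_a$, and $B$ is simple if $B\neq\{0\}$ and $\{0\}$, $B$ are its only ideals. A trivial brace is one with $a\cdot b=a+b$. The semidirect product $H\rtimes G$ of left braces, for a homomorphism from $(G,\cdot)$ to $\mathrm{Aut}(H,+,\cdot)$, has componentwise addition and the semidirect multiplication. For a finite left brace $G$, the wreath product $\mathbb F_p\wr G$ is the semidirect product $H\rtimes G$, where $H$ is the trivial brace of all functions $G\to\mathbb F_p$ and $g\in G$ acts by $(g(f))(x)=f(g^{-1}x)$. Let $n\ge 2$ and let $p_1,\dots,p_n$ be distinct primes with $p_j\mid p_i-1$ for all $1\le i<j\le n$. Let $\overline G_1=\mathbb F_{p_1}$ (trivial brace) and, for $2\le j\le n$, let $H_j$ be the trivial brace of all functions $\overline G_{j-1}\to\mathbb F_{p_j}$ and $\overline G_j=(\mathbb F_{p_j}\wr\overline G_{j-1})/N_j$, where $N_j=\{(f,0): f\in H_j\text{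 constant}\}$, an ideal of $\mathbb F_{p_j}\wr\overline G_{j-1}$. Let $A$ be the trivial brace on $\mathbb F_{p_2}\times\dots\times\mathbb F_{p_n}$ and $a=(1,\dots,1)$, a generator of $A$. There exists $\gamma\in\mathbb F_{p_1}^*$ of order $p_2\cdots p_n$. For any such $\gamma$, let $A$ act on $\overline G_1$ by $\alpha'_1(ia)(z)=\gamma^i z$ for $i\in\mathbb Z$, and recursively on $\overline G_j$ by the automorphisms $\alpha'_j(c)$ induced on the quotient by $(f,g)\mapsto(f\circ\alpha'_{j-1}(c)^{-1},\alpha'_{j-1}(c)(g))$. For $f,f'\in H_j$ put $b_j(f,f')=\big(\sum_x f(x)\big)\big(\sum_x f'(x)\big)-\sum_x f(x)f'(x)$. Then $b_j$ induces a form $b'_j$ on $\overline H_j=H_j/\{\text{constants}\}$. Writing the elements of $\overline G_n$ as $(\overline h_n,\dots,\overline h_2,z)$ with $\overline h_j\in\overline H_j$ and $z\in\mathbb F_{p_1}$, let $b\colon\overline G_n\times\overline G_n\to A$ be the symmetric bilinear form $b\big((\overline h_n,\dots,\overline h_2,z),(\overline h'_n,\dots,\overline h'_2,z')\big)=(b'_2(\overline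 h_2,\overline h'_2),\dots,b'_n(\overline h_n,\overline h'_n))$. Then the asymmetric product $\overline G_n\rtimes_\circ A$, that is, the set $\overline G_n\times A$ with $$(t_1,s_1)+(t_2,s_2)=(t_1+t_2,\ s_1+s_2+b(t_1,t_2)),\qquad (t_1,s_1)\cdot(t_2,s_2)=(t_1\cdot\alpha'_n(s_1)(t_2),\ s_1\cdot s_2),$$ is a finite simple left brace, and its multiplicative group is solvable of derived length exactly $n+1$. -/

import Mathlib

open scoped BigOperators

/-- A left brace: an abelian group `(B, +)` and a group `(B, *)` on the same set
with `a * (b + c) + a = a * b + a * c`. -/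
class LeftBrace (B : Type*) extends AddCommGroup B, Group B where
  brace_mul_add : ∀ a b c : B, a * (b + c) + a = a * b + a * c

namespace LeftBrace

variable {B : Type*} [LeftBrace B]

theorem one_eq_zero : (1 : B) = 0 := by
  have h := brace_mul_add (1 : B) 0 0
  simpa using h

theorem mul_zero' (a : B) : a * 0 = a := by
  rw [← one_eq_zero, mul_one]

/-- The lambda map `λ_a(b) = a * b - a`. -/
def lam (a b : B) : B := a * b - a

theorem mul_eq_lam_add (a b : B) : a * b = lam a b + a := by
  simp [lam]

theorem mul_add' (a b c : B) : a * (b + c) = a * b + a * c - a :=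
  eq_sub_of_add_eq (brace_mul_add a b c)

theorem lam_add (a b c : B) : lam a (b + c) = lam a b + lam a c := by
  simp only [lam, mul_add']; abel

theorem lam_mul (a b c : B) : lam (a * b) c = lam a (lam b c) := by
  have h := mul_add' a (b * c - b) b
  rw [sub_add_cancel] at h
  simp only [lam, mul_assoc, h]; abel

theorem lam_one (b : B) : lam 1 b = b := by
  rw [lam, one_mul, one_eq_zero, sub_zero]

theorem lam_inv_lam (a b : B) : lam a⁻¹ (lam a b) = b := by
  rw [← lam_mul, inv_mul_cancel, lam_one]

theorem lam_lam_inv (a b : B) : lam a (lam a⁻¹ b) = b := by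
  rw [← lam_mul, mul_inv_cancel, lam_one]

/-- An ideal of a left brace: a normal subgroup of `(B, *)` that is stable under all
the maps `λ_b`. -/
structure IsIdeal (N : Subgroup B) : Prop where
  normal : N.Normal
  lam_mem : ∀ b : B, ∀ a ∈ N, lam b a ∈ N

variable (B) in
/-- A left brace is simple if it is nonzero and `{0}` and `B` are its only ideals. -/
def IsSimple : Prop :=
  Nontrivial B ∧ ∀ N : Subgroup B, IsIdeal N → N = ⊥ ∨ N = ⊤

namespace IsIdeal

variable {N : Subgroup B}

theorem inv_mul_mem_iff (hN : IsIdeal N) (a b : B) : a⁻¹ * b ∈ N ↔ b - a ∈ N := by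
  have key : b - a = lam a (a⁻¹ * b) := by simp [lam]
  rw [key]
  refine ⟨hN.lam_mem a _, fun h => ?_⟩
  have := hN.lam_mem a⁻¹ _ h
  rwa [lam_inv_lam] at this

theorem zero_mem (_hN : IsIdeal N) : (0 : B) ∈ N := by
  rw [← one_eq_zero]; exact N.one_mem

theorem add_mem (hN : IsIdeal N) {a b : B} (ha : a ∈ N) (hb : b ∈ N) : a + b ∈ N := by
  have h : a + b = b * lam b⁻¹ a := by rw [mul_eq_lam_add, lam_lam_inv]
  rw [h]
  exact N.mul_mem hb (hN.lam_mem _ _ ha)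

theorem neg_mem (hN : IsIdeal N) {a : B} (ha : a ∈ N) : -a ∈ N := by
  have h : -a = lam a a⁻¹ := by simp [lam, one_eq_zero]
  rw [h]
  exact hN.lam_mem _ _ (N.inv_mem ha)

end IsIdeal

/-- The quotient of a left brace by an ideal `N`: the set of cosets of `N`
(the cosets `a * N` and `a + N` coincide), with both induced operations. -/
def BraceQuotient {N : Subgroup B} (_hN : IsIdeal N) : Type _ := B ⧸ N

namespace BraceQuotient

variable {N : Subgroup B} (hN : IsIdeal N)

/-- The class of an element modulo an ideal. -/
def mk (a : B) : BraceQuotient hN := (QuotientGroup.mk a : B ⧸ N)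

theorem mk_surjective : Function.Surjective (mk hN) := QuotientGroup.mk_surjective

theorem mk_eq_iff {a b : B} : mk hN a = mk hN b ↔ b - a ∈ N := by
  rw [← hN.inv_mul_mem_iff]
  exact QuotientGroup.eq

instance : Group (BraceQuotient hN) :=
  haveI := hN.normal
  inferInstanceAs (Group (B ⧸ N))

/-- Descent of a function to the quotient. -/
def lift {X : Type*} (f : B → X) (hf : ∀ a b, b - a ∈ N → f a = f b) : BraceQuotient hN → X :=
  Quotient.lift (s := QuotientGroup.leftRel N) f fun a b hab =>
    hf a b ((hN.inv_mul_mem_iff a b).1 (QuotientGroup.leftRel_apply.1 hab))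

@[simp] theorem lift_mk {X : Type*} (f : B → X) (hf : ∀ a b, b - a ∈ N → f a = f b) (a : B) :
    lift hN f hf (mk hN a) = f a := rfl

instance : Zero (BraceQuotient hN) := ⟨mk hN 0⟩

instance : Add (BraceQuotient hN) :=
  ⟨fun x y => lift hN (fun a => lift hN (fun b => mk hN (a + b)) (by
      intro b b' h
      rw [mk_eq_iff]
      simpa using h) y) (by
      intro a a' h
      obtain ⟨b, rfl⟩ := mk_surjective hN y
      simp only [lift_mk, mk_eq_iff]
      simpa using h) x⟩

instance : Neg (BraceQuotient hN) :=
  ⟨lift hN (fun a => mk hN (-a)) (by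
      intro a a' h
      rw [mk_eq_iff]
      have := hN.neg_mem h
      rwa [neg_sub, ← neg_sub_neg] at this)⟩

theorem mk_add (a b : B) : mk hN (a + b) = mk hN a + mk hN b := rfl

theorem mk_mul (a b : B) : mk hN (a * b) = mk hN a * mk hN b := rfl

theorem mk_neg (a : B) : mk hN (-a) = -mk hN a := rfl

theorem mk_zero : mk hN 0 = 0 := rfl

instance : LeftBrace (BraceQuotient hN) where
  add_assoc x y z := by
    obtain ⟨a, rfl⟩ := mk_surjective hN x
    obtain ⟨b, rfl⟩ := mk_surjective hN y
    obtain ⟨c, rfl⟩ := mk_surjective hN z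
    simp only [← mk_add, add_assoc]
  zero_add x := by
    obtain ⟨a, rfl⟩ := mk_surjective hN x
    simp only [← mk_zero, ← mk_add, zero_add]
  add_zero x := by
    obtain ⟨a, rfl⟩ := mk_surjective hN x
    simp only [← mk_zero, ← mk_add, add_zero]
  nsmul := nsmulRec
  zsmul := zsmulRec
  neg_add_cancel x := by
    obtain ⟨a, rfl⟩ := mk_surjective hN x
    simp only [← mk_zero, ← mk_neg, ← mk_add, neg_add_cancel]
  add_comm x y := by
    obtain ⟨a, rfl⟩ := mk_surjective hN x
    obtain ⟨b, rfl⟩ := mk_surjective hN y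
    simp only [← mk_add, add_comm]
  __ := (inferInstance : Group (BraceQuotient hN))
  brace_mul_add x y z := by
    obtain ⟨a, rfl⟩ := mk_surjective hN x
    obtain ⟨b, rfl⟩ := mk_surjective hN y
    obtain ⟨c, rfl⟩ := mk_surjective hN z
    simp only [← mk_add, ← mk_mul, brace_mul_add]

theorem mk_lam (a b : B) : mk hN (lam a b) = lam (mk hN a) (mk hN b) := by
  simp only [lam, sub_eq_add_neg, mk_add, mk_mul, mk_neg]

/-- An automorphism of a left brace that maps `N` to `N` induces an automorphism of the
quotient by `N`. Here and below `RingAut B` is the group of bijections `B → B` that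
preserve `+` and `*`, that is, `Aut(B, +, ·)`. -/
def mapAut (e : RingAut B) (he : ∀ a, a ∈ N ↔ e a ∈ N) : RingAut (BraceQuotient hN) where
  toFun := lift hN (fun a => mk hN (e a)) (by
    intro a b h
    rw [mk_eq_iff, ← map_sub]
    exact (he _).1 h)
  invFun := lift hN (fun a => mk hN (e.symm a)) (by
    intro a b h
    rw [mk_eq_iff, ← map_sub]
    refine (he _).2 ?_
    rwa [RingEquiv.apply_symm_apply])
  left_inv x := by
    obtain ⟨a, rfl⟩ := mk_surjective hN x
    simp
  right_inv x := by
    obtain ⟨a, rfl⟩ := mk_surjective hN x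
    simp
  map_mul' x y := by
    obtain ⟨a, rfl⟩ := mk_surjective hN x
    obtain ⟨b, rfl⟩ := mk_surjective hN y
    simp only [← mk_mul, lift_mk, map_mul]
  map_add' x y := by
    obtain ⟨a, rfl⟩ := mk_surjective hN x
    obtain ⟨b, rfl⟩ := mk_surjective hN y
    simp only [← mk_add, lift_mk, map_add]

@[simp] theorem mapAut_mk (e : RingAut B) (he : ∀ a, a ∈ N ↔ e a ∈ N) (a : B) :
    mapAut hN e he (mk hN a) = mk hN (e a) := rfl

end BraceQuotient

/-- Functions with values in a left brace, with pointwise operations. -/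
instance instPi {ι : Type*} : LeftBrace (ι → B) where
  __ := (inferInstance : AddCommGroup (ι → B))
  __ := (inferInstance : Group (ι → B))
  brace_mul_add f g h := funext fun i => brace_mul_add (f i) (g i) (h i)

end LeftBrace

open LeftBrace

/-- The trivial brace on an abelian group `A`: both operations are the addition of `A`. -/
def TrivialBrace (A : Type*) : Type _ := A

namespace TrivialBrace

variable {A : Type*} [AddCommGroup A]

instance : AddCommGroup (TrivialBrace A) := inferInstanceAs (AddCommGroup A)

instance : LeftBrace (TrivialBrace A) where
  mul a b := a + b
  one := 0
  inv a := -a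
  mul_assoc := add_assoc
  one_mul := zero_add
  mul_one := add_zero
  inv_mul_cancel := neg_add_cancel
  brace_mul_add a b c := by
    change a + (b + c) + a = (a + b) + (a + c)
    abel

theorem mul_eq_add (a b : TrivialBrace A) : a * b = a + b := rfl

theorem mul_comm' (a b : TrivialBrace A) : a * b = b * a := by
  rw [mul_eq_add, mul_eq_add, add_comm]

theorem lam_eq (a b : TrivialBrace A) : lam a b = b := by
  simp [lam, mul_eq_add]

/-- The identity map from the trivial brace on `A` to `A`. -/
def val : TrivialBrace A ≃+ A := AddEquiv.refl A

end TrivialBrace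

/-- The data for an asymmetric product of the left braces `T` and `S`: a normalized symmetric
2-cocycle `b` on `(T, +)` with values in `(S, +)` and a homomorphism
`α : (S, *) → Aut(T, +, *)` satisfying the compatibility condition. -/
structure AsymmetricDatum (T S : Type*) [LeftBrace T] [LeftBrace S] where
  b : T → T → S
  α : S →* RingAut T
  b_zero : b 0 0 = 0
  b_symm : ∀ t₁ t₂, b t₁ t₂ = b t₂ t₁
  b_cocycle : ∀ t₁ t₂ t₃, b (t₁ + t₂) t₃ + b t₁ t₂ = b t₁ (t₂ + t₃) + b t₂ t₃
  compat : ∀ (s : S) (t₁ t₂ t₃ : T),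
    s * b t₂ t₃ + b (t₁ * α s (t₂ + t₃)) t₁ = b (t₁ * α s t₂) (t₁ * α s t₃) + s

/-- The underlying set `T × S` of the asymmetric product of `T` by `S` via `b` and `α`. -/
@[ext] structure AsymmetricProduct {T S : Type*} [LeftBrace T] [LeftBrace S]
    (D : AsymmetricDatum T S) where
  fst : T
  snd : S

namespace AsymmetricProduct

variable {T S : Type*} [LeftBrace T] [LeftBrace S] (D : AsymmetricDatum T S)

theorem b_zero_right (t : T) : D.b t 0 = 0 := by
  have h := D.b_cocycle t 0 0
  simp only [add_zero, D.b_zero] at h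
  simpa using h

theorem b_zero_left (t : T) : D.b 0 t = 0 := by
  rw [D.b_symm, b_zero_right]

instance : Add (AsymmetricProduct D) :=
  ⟨fun x y => ⟨x.fst + y.fst, x.snd + y.snd + D.b x.fst y.fst⟩⟩

instance : Zero (AsymmetricProduct D) := ⟨⟨0, 0⟩⟩

instance : Neg (AsymmetricProduct D) := ⟨fun x => ⟨-x.fst, -x.snd - D.b x.fst (-x.fst)⟩⟩

instance : Mul (AsymmetricProduct D) :=
  ⟨fun x y => ⟨x.fst * D.α x.snd y.fst, x.snd * y.snd⟩⟩

instance : One (AsymmetricProduct D) := ⟨⟨1, 1⟩⟩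

instance : Inv (AsymmetricProduct D) := ⟨fun x => ⟨D.α x.snd⁻¹ x.fst⁻¹, x.snd⁻¹⟩⟩

variable {D}

@[simp] theorem add_fst (x y : AsymmetricProduct D) : (x + y).fst = x.fst + y.fst := rfl
@[simp] theorem add_snd (x y : AsymmetricProduct D) :
    (x + y).snd = x.snd + y.snd + D.b x.fst y.fst := rfl
@[simp] theorem zero_fst : (0 : AsymmetricProduct D).fst = 0 := rfl
@[simp] theorem zero_snd : (0 : AsymmetricProduct D).snd = 0 := rfl
@[simp] theorem neg_fst (x : AsymmetricProduct D) : (-x).fst = -x.fst := rfl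
@[simp] theorem neg_snd (x : AsymmetricProduct D) :
    (-x).snd = -x.snd - D.b x.fst (-x.fst) := rfl
@[simp] theorem mul_fst (x y : AsymmetricProduct D) :
    (x * y).fst = x.fst * D.α x.snd y.fst := rfl
@[simp] theorem mul_snd (x y : AsymmetricProduct D) : (x * y).snd = x.snd * y.snd := rfl
@[simp] theorem one_fst : (1 : AsymmetricProduct D).fst = 1 := rfl
@[simp] theorem one_snd : (1 : AsymmetricProduct D).snd = 1 := rfl
@[simp] theorem inv_fst (x : AsymmetricProduct D) : x⁻¹.fst = D.α x.snd⁻¹ x.fst⁻¹ := rfl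
@[simp] theorem inv_snd (x : AsymmetricProduct D) : x⁻¹.snd = x.snd⁻¹ := rfl

theorem aut_one (e : RingAut T) : e 1 = 1 := by
  rw [one_eq_zero]; exact map_zero e

/-- The asymmetric product is a left brace. -/
instance : LeftBrace (AsymmetricProduct D) where
  add_assoc x y z := by
    ext
    · simp [add_assoc]
    · have h := D.b_cocycle x.fst y.fst z.fst
      simp only [add_fst, add_snd]
      have h' := eq_sub_of_add_eq h
      rw [h']; abel
  zero_add x := by ext <;> simp [b_zero_left]
  add_zero x := by ext <;> simp [b_zero_right]
  nsmul := nsmulRec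
  zsmul := zsmulRec
  neg_add_cancel x := by
    ext
    · simp
    · simp only [add_snd, neg_fst, neg_snd, zero_snd, D.b_symm (-x.fst) x.fst]
      abel
  add_comm x y := by
    ext
    · simp [add_comm]
    · simp [add_comm, D.b_symm y.fst x.fst]
  mul_assoc x y z := by
    ext
    · simp [mul_assoc]
    · simp [mul_assoc]
  one_mul x := by ext <;> simp
  mul_one x := by ext <;> simp [aut_one]
  inv_mul_cancel x := by
    ext
    · simp only [mul_fst, inv_fst, inv_snd, one_fst]
      rw [← map_mul, inv_mul_cancel, aut_one]
    · simp
  brace_mul_add x y z := by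
    ext
    · simp [brace_mul_add]
    · have h := eq_sub_of_add_eq' (D.compat x.snd x.fst y.fst z.fst)
      simp only [add_fst, add_snd, mul_fst, mul_snd, mul_add', h]
      abel

end AsymmetricProduct

/-- The semidirect product `H ⋊ G` of left braces with respect to
`σ : (G, *) → Aut(H, +, *)`: the sum is componentwise and
`(h, g) * (h', g') = (h * σ_g(h'), g * g')`, that is, the cocycle is zero. -/
def semidirectDatum {H G : Type*} [LeftBrace H] [LeftBrace G] (σ : G →* RingAut H) :
    AsymmetricDatum H G where
  b _ _ := 0
  α := σ
  b_zero := rfl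
  b_symm _ _ := rfl
  b_cocycle _ _ _ := rfl
  compat s _ _ _ := by simp [mul_zero']

/-- For an automorphism `e` of the left brace `G₁`, the automorphism `f ↦ f ∘ e⁻¹` of the left
brace of functions `G₁ → G₂`; more generally for any permutation `e`. -/
def hatAut {G₁ : Type*} (G₂ : Type*) [LeftBrace G₂] (e : Equiv.Perm G₁) :
    RingAut (G₁ → G₂) where
  toFun f x := f (e.symm x)
  invFun f x := f (e x)
  left_inv f := by ext x; simp
  right_inv f := by ext x; simp
  map_mul' _ _ := rfl
  map_add' _ _ := rfl

/-- The action of `(G₁, *)` on the functions `G₁ → G₂`, `σ(g)(f)(x) = f(g⁻¹ * x)`. -/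
def wreathAction (G₂ G₁ : Type*) [LeftBrace G₂] [LeftBrace G₁] :
    G₁ →* RingAut (G₁ → G₂) where
  toFun g := hatAut G₂ (Equiv.mulLeft g)
  map_one' := by
    apply RingEquiv.ext; intro f; funext x
    change f (1⁻¹ * x) = f x
    simp
  map_mul' g h := by
    apply RingEquiv.ext; intro f; funext x
    change f ((g * h)⁻¹ * x) = f (h⁻¹ * (g⁻¹ * x))
    simp [mul_assoc]

/-- The wreath product `G₂ ≀ G₁` of left braces for finite `G₁` (so that every function
`G₁ → G₂` has finite support). -/
abbrev Wreath (G₂ G₁ : Type*) [LeftBrace G₂] [LeftBrace G₁] [Finite G₁] : Type _ :=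
  AsymmetricProduct (semidirectDatum (wreathAction G₂ G₁))

namespace Wreath

variable {G₂ G₁ : Type*} [LeftBrace G₂] [LeftBrace G₁] [Finite G₁]

/-- The automorphism of `G₂ ≀ G₁` induced by an automorphism `e` of `G₁`. -/
def inducedAut (e : RingAut G₁) : RingAut (Wreath G₂ G₁) where
  toFun w := ⟨hatAut G₂ e.toEquiv w.fst, e w.snd⟩
  invFun w := ⟨hatAut G₂ e.symm.toEquiv w.fst, e.symm w.snd⟩
  left_inv w := by
    ext x
    · simp [hatAut]
    · simp
  right_inv w := by
    ext x
    · simp [hatAut]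
    · simp
  map_mul' v w := by
    ext x
    · have h2 : e.symm ((e v.snd)⁻¹ * x) = v.snd⁻¹ * e.symm x := by
        rw [map_mul]
        congr 1
        have := map_inv e.toMulEquiv v.snd
        change e (v.snd⁻¹) = (e v.snd)⁻¹ at this
        rw [← this, RingEquiv.symm_apply_apply]
      change v.fst (e.symm x) * w.fst (v.snd⁻¹ * e.symm x) =
        v.fst (e.symm x) * w.fst (e.symm ((e v.snd)⁻¹ * x))
      rw [h2]
    · exact map_mul e v.snd w.snd
  map_add' v w := by
    ext x
    · rfl
    · change e (v.snd + w.snd + 0) = e v.snd + e w.snd + 0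
      simp

end Wreath

section Step

variable (q : ℕ) (G : Type) [LeftBrace G] [Finite G]

/-- The subgroup `N = {(f, 0) : f constant}` of `𝔽_q ≀ G`. -/
def constSubgroup : Subgroup (Wreath (TrivialBrace (ZMod q)) G) where
  carrier := {w | (∃ z, w.fst = Function.const G z) ∧ w.snd = 0}
  mul_mem' := by
    rintro v w ⟨⟨z, hz⟩, hv⟩ ⟨⟨y, hy⟩, hw⟩
    refine ⟨⟨z * y, ?_⟩, ?_⟩
    · funext x
      simp [hz, hy, semidirectDatum, wreathAction, hatAut]
    · simp [hv, hw, mul_zero']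
  one_mem' := ⟨⟨1, rfl⟩, one_eq_zero⟩
  inv_mem' := by
    rintro w ⟨⟨z, hz⟩, hw⟩
    refine ⟨⟨z⁻¹, ?_⟩, ?_⟩
    · funext x
      simp [hz, semidirectDatum, wreathAction, hatAut]
    · simp [hw, ← one_eq_zero]

variable {q G}

theorem mem_constSubgroup {w : Wreath (TrivialBrace (ZMod q)) G} :
    w ∈ constSubgroup q G ↔ (∃ z, w.fst = Function.const G z) ∧ w.snd = 0 := Iff.rfl

variable (q G)

theorem constSubgroup_isIdeal : IsIdeal (constSubgroup q G) where
  normal := by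
    constructor
    rintro w ⟨⟨z, hz⟩, hw⟩ v
    refine ⟨⟨z, ?_⟩, ?_⟩
    · funext x
      simp [hz, hw, ← one_eq_zero (B := G), semidirectDatum, wreathAction, hatAut]
      rw [TrivialBrace.mul_comm', inv_mul_cancel_left]
    · simp [hw, ← one_eq_zero (B := G)]
  lam_mem := by
    rintro v w ⟨⟨z, hz⟩, hw⟩
    refine ⟨⟨z, ?_⟩, ?_⟩
    · funext x
      simp [lam, sub_eq_add_neg, hz, semidirectDatum, wreathAction, hatAut]
      simp [TrivialBrace.mul_eq_add]
    · simp [lam, sub_eq_add_neg, hw, mul_zero', semidirectDatum]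

/-- The quotient of `𝔽_q ≀ G` by the ideal `N` of constant functions. -/
abbrev WreathQuot : Type := BraceQuotient (constSubgroup_isIdeal q G)

end Step

section Form

variable {q : ℕ} {G : Type} [Fintype G]

/-- The augmentation `ε(f) = ∑_g f(g)`. -/
def augmentation (f : G → TrivialBrace (ZMod q)) : ZMod q :=
  ∑ g, TrivialBrace.val (f g)

/-- The form `ε(f₁) · ε(f₂) - ε(f₁ • f₂)` on functions `G → 𝔽_q`, where `f₁ • f₂` is the
pointwise product for the multiplication of the field `𝔽_q`. -/
def functionForm (f₁ f₂ : G → TrivialBrace (ZMod q)) : ZMod q :=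
  augmentation f₁ * augmentation f₂ -
    ∑ g, TrivialBrace.val (f₁ g) * TrivialBrace.val (f₂ g)

theorem functionForm_add_left (f₁ f₂ f : G → TrivialBrace (ZMod q)) :
    functionForm (f₁ + f₂) f = functionForm f₁ f + functionForm f₂ f := by
  simp only [functionForm, augmentation, Pi.add_apply, map_add, Finset.sum_add_distrib, add_mul]
  ring

theorem functionForm_symm (f₁ f₂ : G → TrivialBrace (ZMod q)) :
    functionForm f₁ f₂ = functionForm f₂ f₁ := by
  simp only [functionForm, mul_comm]

theorem functionForm_hatAut (e : Equiv.Perm G) (f₁ f₂ : G → TrivialBrace (ZMod q)) :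
    functionForm (hatAut _ e f₁) (hatAut _ e f₂) = functionForm f₁ f₂ := by
  have h : ∀ f : G → ZMod q, ∑ g, f (e.symm g) = ∑ g, f g := fun f => Equiv.sum_comp e.symm f
  have h1 := h fun g => TrivialBrace.val (f₁ g)
  have h2 := h fun g => TrivialBrace.val (f₂ g)
  have h3 := h fun g => TrivialBrace.val (f₁ g) * TrivialBrace.val (f₂ g)
  change (∑ g, TrivialBrace.val (f₁ (e.symm g))) * (∑ g, TrivialBrace.val (f₂ (e.symm g))) -
    ∑ g, TrivialBrace.val (f₁ (e.symm g)) * TrivialBrace.val (f₂ (e.symm g)) = _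
  rw [h1, h2, h3]
  rfl

theorem functionForm_const (hG : ((Fintype.card G : ℕ) : ZMod q) = 1)
    (z : TrivialBrace (ZMod q)) (f : G → TrivialBrace (ZMod q)) :
    functionForm (Function.const G z) f = 0 := by
  simp only [functionForm, augmentation, Function.const_apply, Finset.sum_const,
    Finset.card_univ, nsmul_eq_mul, hG, one_mul, ← Finset.mul_sum, sub_self]

end Form

/-- Primes `p 0, …, p m` (written `p₁, …, pₙ` with `n = m + 1` in one-based numbering) that are
distinct and such that each one divides `p i - 1` for every earlier `p i`. -/
structure IsPrimeChain {m : ℕ} (p : Fin (m + 1) → ℕ) : Prop where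
  prime : ∀ i, (p i).Prime
  injective : Function.Injective p
  dvd : ∀ i j, i < j → p j ∣ p i - 1

namespace IsPrimeChain

variable {m : ℕ} {p : Fin (m + 1) → ℕ}

theorem cast_eq_one (hp : IsPrimeChain p) {i j : Fin (m + 1)} (hij : i < j) :
    ((p i : ℕ) : ZMod (p j)) = 1 := by
  have h := (ZMod.natCast_eq_zero_iff _ _).2 (hp.dvd i j hij)
  rw [Nat.cast_sub (hp.prime i).one_le, Nat.cast_one] at h
  exact sub_eq_zero.1 h

/-- The product `𝔽_{p₂} × ⋯ × 𝔽_{pₙ}` over all the primes except the first one. -/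
abbrev Factors (p : Fin (m + 1) → ℕ) : Type := (k : Fin m) → ZMod (p k.succ)

/-- The trivial brace `A` on `𝔽_{p₂} × ⋯ × 𝔽_{pₙ}`. -/
abbrev A (p : Fin (m + 1) → ℕ) : Type := TrivialBrace (Factors p)

theorem pairwise_coprime (hp : IsPrimeChain p) :
    Pairwise (Function.onFun Nat.Coprime fun k : Fin m => p k.succ) := fun _ _ hij =>
  (Nat.coprime_primes (hp.prime _) (hp.prime _)).2 fun h =>
    hij (Fin.succ_injective _ (hp.injective h))

/-- The element `a = (1, …, 1)` generates `A`. -/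
theorem exists_zsmul (hp : IsPrimeChain p) (x : A p) :
    ∃ i : ℤ, i • (1 : Factors p) = TrivialBrace.val x := by
  let e := ZMod.prodEquivPi (fun k : Fin m => p k.succ) hp.pairwise_coprime
  obtain ⟨i, hi⟩ := ZMod.intCast_surjective (e.symm (TrivialBrace.val x))
  refine ⟨i, ?_⟩
  have := congrArg e hi
  rw [RingEquiv.apply_symm_apply, map_intCast] at this
  rw [zsmul_one]
  exact this

theorem zpow_eq_of_zsmul_eq (hp : IsPrimeChain p) {Γ : Type*} [Group Γ] {γ : Γ}
    (hγ : orderOf γ = ∏ k : Fin m, p k.succ) {i j : ℤ}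
    (h : i • (1 : Factors p) = j • (1 : Factors p)) : γ ^ i = γ ^ j := by
  rw [zpow_eq_zpow_iff_modEq, hγ]
  rw [Int.modEq_iff_dvd]
  push_cast
  refine Finset.prod_dvd_of_coprime ?_ ?_
  · intro a _ b _ hab
    exact Nat.isCoprime_iff_coprime.2 (hp.pairwise_coprime hab)
  · intro k _
    have hk := congrFun h k
    simp only [zsmul_one, Pi.intCast_apply] at hk
    exact (ZMod.intCast_eq_intCast_iff_dvd_sub _ _ _).1 hk

end IsPrimeChain

/-- Multiplication by units of `𝔽_q`, as automorphisms of the trivial brace on `𝔽_q`. -/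
def unitAut (q : ℕ) : (ZMod q)ˣ →* RingAut (TrivialBrace (ZMod q)) where
  toFun u :=
    { toFun := fun z => TrivialBrace.val.symm ((u : ZMod q) * TrivialBrace.val z)
      invFun := fun z => TrivialBrace.val.symm (((u⁻¹ : (ZMod q)ˣ) : ZMod q) * TrivialBrace.val z)
      left_inv := fun z => by simp
      right_inv := fun z => by simp
      map_mul' := fun x y => by simp [TrivialBrace.mul_eq_add, mul_add]
      map_add' := fun x y => by simp [mul_add] }
  map_one' := by
    apply RingEquiv.ext; intro z
    change TrivialBrace.val.symm (1 * TrivialBrace.val z) = z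
    simp
  map_mul' u v := by
    apply RingEquiv.ext; intro z
    change TrivialBrace.val.symm (((u : ZMod q) * v) * TrivialBrace.val z) =
      TrivialBrace.val.symm ((u : ZMod q) *
        TrivialBrace.val (TrivialBrace.val.symm ((v : ZMod q) * TrivialBrace.val z)))
    simp [mul_assoc]

section Construction

open IsPrimeChain

variable {m : ℕ} {p : Fin (m + 1) → ℕ} (hp : IsPrimeChain p)

/-- For `γ ∈ (𝔽_{p₁})ˣ` of order `p₂ ⋯ pₙ`, the action `α₁` of `A` on the trivial brace
`𝔽_{p₁}`: the element `i a` of `A`, with `a = (1, …, 1)` and `i ∈ ℤ`, acts by `z ↦ γ ^ i · z`. -/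
noncomputable def baseAction {γ : (ZMod (p 0))ˣ} (hγ : orderOf γ = ∏ k : Fin m, p k.succ) :
    A p →* RingAut (TrivialBrace (ZMod (p 0))) :=
  (unitAut (p 0)).comp
    { toFun := fun x => γ ^ (hp.exists_zsmul x).choose
      map_one' := by
        rw [← zpow_zero γ]
        refine hp.zpow_eq_of_zsmul_eq hγ ?_
        rw [(hp.exists_zsmul 1).choose_spec, zero_smul]
        rfl
      map_mul' := fun x y => by
        rw [← zpow_add]
        refine hp.zpow_eq_of_zsmul_eq hγ ?_
        rw [(hp.exists_zsmul (x * y)).choose_spec, add_smul, (hp.exists_zsmul x).choose_spec,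
          (hp.exists_zsmul y).choose_spec]
        rfl }

theorem baseAction_apply {γ : (ZMod (p 0))ˣ} (hγ : orderOf γ = ∏ k : Fin m, p k.succ)
    (i : ℤ) (z : ZMod (p 0)) :
    TrivialBrace.val (baseAction hp hγ (TrivialBrace.val.symm (i • (1 : Factors p)))
      (TrivialBrace.val.symm z)) = ((γ ^ i : (ZMod (p 0))ˣ) : ZMod (p 0)) * z := by
  rw [← hp.zpow_eq_of_zsmul_eq hγ
    (hp.exists_zsmul (TrivialBrace.val.symm (i • (1 : Factors p)))).choose_spec]
  rfl

/-- The objects built at the `k`-th step of the recursion (`k = 0` is the first step): a finite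
left brace, an action of `A` on it by automorphisms, and a symmetric bilinear form on it with
values in `𝔽_{p₂} × ⋯ × 𝔽_{pₙ}`, together with the proofs that make the next step and the
asymmetric product well defined. -/
structure Stage {m : ℕ} (p : Fin (m + 1) → ℕ) (k : Fin (m + 1)) where
  carrier : Type
  [brace : LeftBrace carrier]
  [fintype : Fintype carrier]
  action : A p →* RingAut carrier
  form : carrier → carrier → Factors p
  form_add_left : ∀ x y z, form (x + y) z = form x z + form y z
  form_symm : ∀ x y, form x y = form y x
  form_lam : ∀ x y z, form (lam x y) (lam x z) = form y z
  form_action : ∀ c y z, form (action c y) (action c z) = form y z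
  card_eq_one : ∀ j, k < j → ((Fintype.card carrier : ℕ) : ZMod (p j)) = 1

attribute [instance] Stage.brace Stage.fintype

theorem Stage.form_zero_left {i : Fin (m + 1)} (S : Stage p i) (x : S.carrier) :
    S.form 0 x = 0 := by
  have h := S.form_add_left 0 0 x
  simpa using h

theorem Stage.form_add_right {i : Fin (m + 1)} (S : Stage p i) (x y z : S.carrier) :
    S.form x (y + z) = S.form x y + S.form x z := by
  rw [S.form_symm, S.form_add_left, S.form_symm y, S.form_symm z]

/-- The first step: `Ḡ₁ = 𝔽_{p₁}` with the action `α₁` and the zero form. -/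
noncomputable def baseStage {γ : (ZMod (p 0))ˣ} (hγ : orderOf γ = ∏ k : Fin m, p k.succ) :
    Stage p 0 :=
  haveI : NeZero (p 0) := ⟨(hp.prime 0).ne_zero⟩
  haveI : Fintype (TrivialBrace (ZMod (p 0))) := inferInstanceAs (Fintype (ZMod (p 0)))
  { carrier := TrivialBrace (ZMod (p 0))
    action := baseAction hp hγ
    form := fun _ _ => 0
    form_add_left := fun _ _ _ => by simp
    form_symm := fun _ _ => rfl
    form_lam := fun _ _ _ => rfl
    form_action := fun _ _ _ => rfl
    card_eq_one := fun j hj => by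
      rw [← Nat.card_eq_fintype_card]
      have h : Nat.card (TrivialBrace (ZMod (p 0))) = p 0 := Nat.card_zmod (p 0)
      rw [h]
      exact hp.cast_eq_one hj }

variable (k : Fin m) (S : Stage p k.castSucc)

namespace Stage

/-- The wreath product `𝔽_q ≀ Ḡ` at the next step, `q` being the next prime. -/
abbrev W : Type := Wreath (TrivialBrace (ZMod (p k.succ))) S.carrier

/-- The form `((f, g), (f', g')) ↦ b_q(f, f') + b(g, g')` on `𝔽_q ≀ Ḡ`, where `b_q(f, f')`
is placed in the coordinate of `q`. -/
def wreathForm (w v : S.W k) : Factors p :=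
  Pi.single k (functionForm w.fst v.fst) + S.form w.snd v.snd

theorem wreathForm_add_left (w w' v : S.W k) :
    S.wreathForm k (w + w') v = S.wreathForm k w v + S.wreathForm k w' v := by
  have h : (w + w').snd = w.snd + w'.snd := add_zero _
  simp only [wreathForm, AsymmetricProduct.add_fst, h, functionForm_add_left, S.form_add_left,
    Pi.single_add]
  abel

theorem wreathForm_symm (w v : S.W k) : S.wreathForm k w v = S.wreathForm k v w := by
  simp only [wreathForm, functionForm_symm w.fst, S.form_symm w.snd]

theorem wreathForm_const {w : S.W k} (hw : w ∈ constSubgroup (p k.succ) S.carrier)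
    (v : S.W k) : S.wreathForm k w v = 0 := by
  obtain ⟨⟨z, hz⟩, hw⟩ := hw
  rw [wreathForm, hz, hw, S.form_zero_left,
    functionForm_const (S.card_eq_one _ k.castSucc_lt_succ)]
  simp

theorem wreathForm_congr {w w' : S.W k}
    (h : w' - w ∈ constSubgroup (p k.succ) S.carrier) (v : S.W k) :
    S.wreathForm k w v = S.wreathForm k w' v := by
  have h2 := S.wreathForm_add_left k (w' - w) w v
  rw [sub_add_cancel, S.wreathForm_const k h, zero_add] at h2
  exact h2.symm

theorem wreathForm_lam (w v v' : S.W k) :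
    S.wreathForm k (lam w v) (lam w v') = S.wreathForm k v v' := by
  have h1 : ∀ u : S.W k, (lam w u).fst = hatAut _ (Equiv.mulLeft w.snd) u.fst := by
    intro u
    funext x
    simp [lam, sub_eq_add_neg, semidirectDatum, wreathAction, TrivialBrace.mul_eq_add]
  have h2 : ∀ u : S.W k, (lam w u).snd = lam w.snd u.snd := by
    intro u
    simp [lam, sub_eq_add_neg, semidirectDatum]
  simp only [wreathForm, h1, h2, functionForm_hatAut, S.form_lam]

theorem wreathForm_induced (c : A p) (v v' : S.W k) :
    S.wreathForm k (Wreath.inducedAut (S.action c) v) (Wreath.inducedAut (S.action c) v') =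
      S.wreathForm k v v' := by
  change Pi.single k (functionForm (hatAut _ (S.action c).toEquiv v.fst)
    (hatAut _ (S.action c).toEquiv v'.fst)) + S.form (S.action c v.snd) (S.action c v'.snd) = _
  rw [functionForm_hatAut, S.form_action]
  rfl

/-- The form on the quotient `(𝔽_q ≀ Ḡ) / N` induced by the form on `𝔽_q ≀ Ḡ`. -/
def quotForm (x y : WreathQuot (p k.succ) S.carrier) : Factors p :=
  BraceQuotient.lift (constSubgroup_isIdeal (p k.succ) S.carrier)
    (fun w => BraceQuotient.lift (constSubgroup_isIdeal (p k.succ) S.carrier)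
      (fun v => S.wreathForm k w v)
      (fun v v' h => by
        rw [S.wreathForm_symm k w, S.wreathForm_congr k h, S.wreathForm_symm]) y)
    (fun w w' h => by
      obtain ⟨v, rfl⟩ := BraceQuotient.mk_surjective _ y
      simp only [BraceQuotient.lift_mk]
      exact S.wreathForm_congr k h v) x

theorem induced_mem (e : RingAut S.carrier) (w : S.W k) :
    w ∈ constSubgroup (p k.succ) S.carrier ↔
      Wreath.inducedAut e w ∈ constSubgroup (p k.succ) S.carrier := by
  have hs : (Wreath.inducedAut e w).snd = e w.snd := rfl
  have hf : ∀ x, (Wreath.inducedAut e w).fst (e x) = w.fst x := fun x => by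
    change w.fst (e.symm (e x)) = _
    rw [RingEquiv.symm_apply_apply]
  rw [mem_constSubgroup, mem_constSubgroup, hs]
  refine and_congr (exists_congr fun z => ⟨fun h => ?_, fun h => ?_⟩) ?_
  · funext x
    rw [← e.apply_symm_apply x, hf, h]
    rfl
  · funext x
    rw [← hf, h]
    rfl
  · exact (EmbeddingLike.map_eq_zero_iff (f := e)).symm

/-- The action of `A` on `(𝔽_q ≀ Ḡ) / N` induced by its action on `Ḡ`. -/
def quotAction : A p →* RingAut (WreathQuot (p k.succ) S.carrier) where
  toFun c := BraceQuotient.mapAut _ (Wreath.inducedAut (S.action c)) (S.induced_mem k (S.action c))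
  map_one' := by
    apply RingEquiv.ext; intro x
    obtain ⟨w, rfl⟩ := BraceQuotient.mk_surjective _ x
    rw [BraceQuotient.mapAut_mk, map_one]
    rfl
  map_mul' c d := by
    apply RingEquiv.ext; intro x
    obtain ⟨w, rfl⟩ := BraceQuotient.mk_surjective _ x
    rw [BraceQuotient.mapAut_mk, map_mul]
    rfl

end Stage

theorem finite_trivialBrace (hp : IsPrimeChain p) (i : Fin (m + 1)) :
    Finite (TrivialBrace (ZMod (p i))) :=
  haveI : NeZero (p i) := ⟨(hp.prime i).ne_zero⟩
  inferInstanceAs (Finite (ZMod (p i)))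

/-- The underlying set of an asymmetric product is `T × S`. -/
def AsymmetricProduct.equivProd {T S : Type*} [LeftBrace T] [LeftBrace S]
    (D : AsymmetricDatum T S) : AsymmetricProduct D ≃ T × S where
  toFun x := (x.fst, x.snd)
  invFun x := ⟨x.1, x.2⟩
  left_inv _ := rfl
  right_inv _ := rfl

instance {T S : Type*} [LeftBrace T] [LeftBrace S] [Finite T] [Finite S]
    (D : AsymmetricDatum T S) : Finite (AsymmetricProduct D) :=
  Finite.of_equiv _ (AsymmetricProduct.equivProd D).symm

theorem finite_wreathQuot (hp : IsPrimeChain p) :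
    Finite (WreathQuot (p k.succ) S.carrier) :=
  haveI := finite_trivialBrace hp k.succ
  Finite.of_surjective _ (BraceQuotient.mk_surjective _)

theorem card_wreathQuot :
    Nat.card (WreathQuot (p k.succ) S.carrier) * p k.succ =
      p k.succ ^ Fintype.card S.carrier * Fintype.card S.carrier := by
  have hz : Nat.card (TrivialBrace (ZMod (p k.succ))) = p k.succ := Nat.card_zmod _
  have h := Subgroup.card_eq_card_quotient_mul_card_subgroup
    (constSubgroup (p k.succ) S.carrier)
  have hW : Nat.card (S.W k) = p k.succ ^ Fintype.card S.carrier * Fintype.card S.carrier := by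
    rw [Nat.card_congr (AsymmetricProduct.equivProd _), Nat.card_prod, Nat.card_fun, hz,
      Nat.card_eq_fintype_card]
  have hN : Nat.card (constSubgroup (p k.succ) S.carrier) = p k.succ := by
    refine Eq.trans ?_ hz
    refine (Nat.card_congr (Equiv.ofBijective
      (fun z => (⟨⟨Function.const _ z, 0⟩, ⟨z, rfl⟩, rfl⟩ :
        constSubgroup (p k.succ) S.carrier)) ⟨fun z z' hzz => ?_, ?_⟩)).symm
    · exact congrFun (congrArg (fun w => w.1.fst) hzz) 0
    · rintro ⟨w, ⟨z, hz⟩, hw⟩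
      refine ⟨z, Subtype.ext ?_⟩
      exact AsymmetricProduct.ext hz.symm hw.symm
  rw [hW, hN] at h
  exact h.symm

/-- The recursive step: from `Ḡ_{j-1}` to `Ḡ_j = (𝔽_{p_j} ≀ Ḡ_{j-1}) / N_j` with the induced
action of `A` and the form extended by `b'_j`. -/
noncomputable def nextStage : Stage p k.succ :=
  haveI := finite_wreathQuot k S hp
  haveI : Fintype (WreathQuot (p k.succ) S.carrier) := Fintype.ofFinite _
  { carrier := WreathQuot (p k.succ) S.carrier
    action := S.quotAction k
    form := S.quotForm k
    form_add_left := fun x y z => by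
      obtain ⟨x, rfl⟩ := BraceQuotient.mk_surjective _ x
      obtain ⟨y, rfl⟩ := BraceQuotient.mk_surjective _ y
      obtain ⟨z, rfl⟩ := BraceQuotient.mk_surjective _ z
      exact S.wreathForm_add_left k x y z
    form_symm := fun x y => by
      obtain ⟨x, rfl⟩ := BraceQuotient.mk_surjective _ x
      obtain ⟨y, rfl⟩ := BraceQuotient.mk_surjective _ y
      exact S.wreathForm_symm k x y
    form_lam := fun x y z => by
      obtain ⟨x, rfl⟩ := BraceQuotient.mk_surjective _ x
      obtain ⟨y, rfl⟩ := BraceQuotient.mk_surjective _ y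
      obtain ⟨z, rfl⟩ := BraceQuotient.mk_surjective _ z
      rw [← BraceQuotient.mk_lam, ← BraceQuotient.mk_lam]
      exact S.wreathForm_lam k x y z
    form_action := fun c y z => by
      obtain ⟨y, rfl⟩ := BraceQuotient.mk_surjective _ y
      obtain ⟨z, rfl⟩ := BraceQuotient.mk_surjective _ z
      exact S.wreathForm_induced k c y z
    card_eq_one := fun j hj => by
      have h := congrArg (Nat.cast (R := ZMod (p j))) (card_wreathQuot k S)
      push_cast at h
      rw [hp.cast_eq_one hj, S.card_eq_one j (k.castSucc_lt_succ.trans hj), one_pow, mul_one,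
        mul_one, Nat.card_eq_fintype_card] at h
      exact h }

/-- All the steps of the recursion. -/
noncomputable def stage {γ : (ZMod (p 0))ˣ} (hγ : orderOf γ = ∏ k : Fin m, p k.succ) :
    (k : Fin (m + 1)) → Stage p k :=
  Fin.induction (baseStage hp hγ) fun k S => nextStage hp k S

/-- The left brace `Ḡₙ`, for `n = m + 1`. -/
abbrev Gbar {γ : (ZMod (p 0))ˣ} (hγ : orderOf γ = ∏ k : Fin m, p k.succ) : Type :=
  (stage hp hγ (Fin.last m)).carrier

/-- The action `α'ₙ : A → Aut(Ḡₙ, +, ·)` and the bilinear form `b : Ḡₙ × Ḡₙ → A`, as data for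
an asymmetric product. -/
noncomputable def mainDatum {γ : (ZMod (p 0))ˣ} (hγ : orderOf γ = ∏ k : Fin m, p k.succ) :
    AsymmetricDatum (Gbar hp hγ) (A p) where
  b x y := TrivialBrace.val.symm ((stage hp hγ (Fin.last m)).form x y)
  α := (stage hp hγ (Fin.last m)).action
  b_zero := by rw [Stage.form_zero_left, map_zero]
  b_symm x y := by rw [Stage.form_symm]
  b_cocycle x y z := by
    rw [← map_add, ← map_add, Stage.form_add_left, Stage.form_add_right]
    congr 1; abel
  compat s x y z := by
    rw [TrivialBrace.mul_eq_add, add_comm s, add_right_comm]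
    congr 1
    rw [← map_add]
    congr 1
    rw [mul_eq_lam_add x, mul_eq_lam_add x, mul_eq_lam_add x, map_add, lam_add]
    simp only [Stage.form_add_left, Stage.form_add_right, Stage.form_lam, Stage.form_action,
      Stage.form_symm _ x (lam x _)]
    abel

/-- The left brace `Ḡₙ ⋊_∘ A`. -/
abbrev SimpleBrace {γ : (ZMod (p 0))ˣ} (hγ : orderOf γ = ∏ k : Fin m, p k.succ) : Type :=
  AsymmetricProduct (mainDatum hp hγ)

end Construction

/-- The group `G` is solvable of derived length exactly `d`. -/
def HasDerivedLength (G : Type*) [Group G] (d : ℕ) : Prop :=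
  derivedSeries G d = ⊥ ∧ ∀ k < d, derivedSeries G k ≠ ⊥

open IsPrimeChain

variable {m : ℕ} {p : Fin (m + 1) → ℕ}

namespace Stage

/-! Run the recursion on the asymmetric products of every stage with `A`, not just of the last one.
Multiplicatively, the product at the next stage is (functions modulo constants) ⋊ (product at the
present stage): each element is `lay f * emb e`, and `e = (t, s)` acts on functions through the
permutation `x ↦ t * α_s(x)` of the carrier. Additively the layer is twisted by its form. The
arithmetic input is that the carrier has cardinality congruent to `1` modulo the next prime `q`.
Hence the radical of the form is exactly the constants, a difference `f - e f` that is constant must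
vanish, and the sum of `f - g f` over all `g` is `f` minus a constant.

Simplicity. The permutation action is faithful, so commutators with the layer produce a nonconstant
`f` in any nonzero ideal of the last stage (`exists_lay_mem`). Comparing brace sums with products
puts the values of the form at `f` into the ideal (`lay_form_mem`), so it contains some `(0, c)`
with `c ≠ 0`. At the base, `c` acts as a scalar `u ≠ 1`, and commutators give all of the first prime
field. Climbing back up, each stage's translations generate the next layer, and the form on that
layer gives one new coordinate of `A` (`Absorbing.next`). At the last stage this is everything.

Derived length. The base is metabelian and each abelian layer adds at most one step. Conversely, if
`(g, 1)` with `g ≠ 1` lies in the `d`-th derived subgroup, then `(1 - g)² δ₁` is nonconstant and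
lies in the next derived subgroup one layer up (`MeetsDerived.next`). -/

/-- The action and the form of a stage, as data for an asymmetric product with `A`. -/
def datum {i : Fin (m + 1)} (S : Stage p i) : AsymmetricDatum S.carrier (A p) where
  b x y := TrivialBrace.val.symm (S.form x y)
  α := S.action
  b_zero := by rw [Stage.form_zero_left, map_zero]
  b_symm x y := by rw [Stage.form_symm]
  b_cocycle x y z := by
    rw [← map_add, ← map_add, Stage.form_add_left, Stage.form_add_right]
    congr 1; abel
  compat s x y z := by
    rw [TrivialBrace.mul_eq_add, add_comm s, add_right_comm]
    congr 1
    rw [← map_add]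
    congr 1
    rw [mul_eq_lam_add x, mul_eq_lam_add x, mul_eq_lam_add x, map_add, lam_add]
    simp only [Stage.form_add_left, Stage.form_add_right, Stage.form_lam, Stage.form_action,
      Stage.form_symm _ x (lam x _)]
    abel

/-- The asymmetric product of the brace of a stage by `A`. -/
abbrev Asym {i : Fin (m + 1)} (S : Stage p i) : Type := AsymmetricProduct S.datum

/-! ### Permutations of the carrier by the asymmetric product -/

section Basic

variable {i : Fin (m + 1)} (S : Stage p i)

theorem card_nsmul {j : Fin (m + 1)} (h : i < j) (x : ZMod (p j)) :
    Fintype.card S.carrier • x = x := by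
  rw [nsmul_eq_mul, S.card_eq_one j h, one_mul]

/-- The permutation `x ↦ t * α_s(x)` of the carrier given by the element `(t, s)`. -/
def perm (e : S.Asym) : Equiv.Perm S.carrier :=
  (S.action e.snd).toEquiv.trans (Equiv.mulLeft e.fst)

theorem perm_apply (e : S.Asym) (x : S.carrier) : S.perm e x = e.fst * S.action e.snd x := rfl

/-- The action of `A` on the brace of the stage is faithful. -/
def Faithful : Prop := ∀ c : A p, (∀ x, S.action c x = x) → c = 0

variable {S}

/-- Automorphisms fix `1`, so the image of `1` reads off the first component; what remains is the
action of `A` alone. -/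
theorem Faithful.eq_one_of_perm (hS : S.Faithful) {e : S.Asym} (h : ∀ x, S.perm e x = x) :
    e = 1 := by
  have h1 : e.fst = 1 := by
    have := h 1
    rwa [perm_apply, AsymmetricProduct.aut_one, mul_one] at this
  refine AsymmetricProduct.ext h1 (hS _ fun x => ?_)
  have := h x
  rwa [perm_apply, h1, one_mul] at this

theorem right_add (c d : A p) :
    (⟨0, c + d⟩ : S.Asym) = ⟨0, c⟩ + ⟨0, d⟩ := by
  ext1
  · simp
  · simp [AsymmetricProduct.b_zero_left]

theorem mk_eq_mul (g : S.carrier) (c : A p) : (⟨g, c⟩ : S.Asym) = ⟨g, 0⟩ * ⟨0, c⟩ := by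
  ext1
  · simp [mul_zero']
  · simp [TrivialBrace.mul_eq_add]

end Basic

/-! ### The next stage as a layer of functions over the present one -/

section Next

variable {k : Fin m} (S : Stage p k.castSucc) (hp : IsPrimeChain p)

/-- The stage after `S`. -/
noncomputable abbrev next : Stage p k.succ := nextStage hp k S

/-- The quotient map from the wreath product to the next stage. -/
noncomputable def nextMk (w : S.W k) : (S.next hp).carrier :=
  BraceQuotient.mk (constSubgroup_isIdeal (p k.succ) S.carrier) w

theorem nextMk_surjective : Function.Surjective (S.nextMk hp) :=
  BraceQuotient.mk_surjective (constSubgroup_isIdeal (p k.succ) S.carrier)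

theorem nextMk_mul (w v : S.W k) : S.nextMk hp (w * v) = S.nextMk hp w * S.nextMk hp v := rfl

theorem nextMk_add (w v : S.W k) : S.nextMk hp (w + v) = S.nextMk hp w + S.nextMk hp v := rfl

theorem nextMk_one : S.nextMk hp 1 = 1 := rfl

theorem nextMk_eq_iff {w v : S.W k} :
    S.nextMk hp w = S.nextMk hp v ↔ v - w ∈ constSubgroup (p k.succ) S.carrier :=
  BraceQuotient.mk_eq_iff _

theorem action_nextMk (c : A p) (w : S.W k) :
    (S.next hp).action c (S.nextMk hp w) = S.nextMk hp (Wreath.inducedAut (S.action c) w) := rfl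

theorem form_nextMk (w v : S.W k) :
    (S.next hp).form (S.nextMk hp w) (S.nextMk hp v) = S.wreathForm k w v := rfl

/-- Functions on the carrier with values in the next prime field. -/
abbrev Fun : Type := S.carrier → TrivialBrace (ZMod (p k.succ))

theorem functionForm_zero_left (f : S.Fun) : functionForm 0 f = 0 := by
  have := functionForm_add_left 0 0 f
  simpa using this

/-- The embedding of the asymmetric product of a stage in that of the next stage. -/
noncomputable def emb : S.Asym →* (S.next hp).Asym where
  toFun e := ⟨S.nextMk hp ⟨0, e.fst⟩, e.snd⟩
  map_one' := by
    ext1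
    · exact S.nextMk_one hp
    · rfl
  map_mul' e e' := by
    ext1
    · change _ = S.nextMk hp _ * (S.next hp).action _ (S.nextMk hp _)
      rw [action_nextMk, ← nextMk_mul]
      refine congrArg (S.nextMk hp) (AsymmetricProduct.ext ?_ rfl)
      change (0 : S.Fun) = 0 * wreathAction _ _ _ (hatAut _ _ 0)
      rw [map_zero, map_zero, mul_zero']
    · rfl

/-- The new form restricts to the old one on zero functions. So `emb` is a brace morphism, and
ideals can be pulled back along it. -/
theorem emb_add (e e' : S.Asym) : S.emb hp (e + e') = S.emb hp e + S.emb hp e' := by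
  ext1
  · change _ = S.nextMk hp _ + S.nextMk hp _
    rw [← nextMk_add]
    refine congrArg (S.nextMk hp) (AsymmetricProduct.ext ?_ ?_)
    · exact (add_zero (0 : S.Fun)).symm
    · exact (add_zero _).symm
  · refine congrArg (fun c : A p => e.snd + e'.snd + c) ?_
    change S.form _ _ = (S.next hp).form (S.nextMk hp _) (S.nextMk hp _)
    rw [form_nextMk, wreathForm, functionForm_zero_left]
    simp

theorem emb_lam (e e' : S.Asym) : S.emb hp (lam e e') = lam (S.emb hp e) (S.emb hp e') := by
  rw [lam, lam, eq_sub_iff_add_eq, ← emb_add, sub_add_cancel, map_mul]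

theorem isIdeal_comap {N : Subgroup (S.next hp).Asym} (hN : IsIdeal N) :
    IsIdeal (N.comap (S.emb hp)) where
  normal := hN.normal.comap _
  lam_mem e a ha := by
    rw [Subgroup.mem_comap, emb_lam]
    exact hN.lam_mem _ _ ha

/-- The functions, as elements of the asymmetric product of the next stage. -/
noncomputable def lay (f : S.Fun) : (S.next hp).Asym := ⟨S.nextMk hp ⟨f, 0⟩, 0⟩

/-- Addition of functions is the brace multiplication on the layer. The brace sum differs from it by
the form, as `lay_add_lay` records. -/
theorem lay_add (f f' : S.Fun) : S.lay hp (f + f') = S.lay hp f * S.lay hp f' := by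
  ext1
  · change _ = S.nextMk hp _ * (S.next hp).action 1 (S.nextMk hp _)
    rw [map_one]
    change _ = S.nextMk hp _ * S.nextMk hp _
    rw [← nextMk_mul]
    refine congrArg (S.nextMk hp) (AsymmetricProduct.ext ?_ ?_)
    · change f + f' = f * wreathAction _ _ 0 f'
      rw [← one_eq_zero, map_one]
      rfl
    · exact (mul_zero' _).symm
  · exact (mul_zero' (0 : A p)).symm

theorem lay_zero : S.lay hp 0 = 1 := one_eq_zero.symm

theorem lay_neg (f : S.Fun) : S.lay hp (-f) = (S.lay hp f)⁻¹ := by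
  rw [eq_inv_iff_mul_eq_one, ← lay_add, neg_add_cancel, lay_zero]

theorem lay_sub (f f' : S.Fun) : S.lay hp (f - f') = S.lay hp f * (S.lay hp f')⁻¹ := by
  rw [sub_eq_add_neg, lay_add, lay_neg]

theorem lay_comm (f f' : S.Fun) : S.lay hp f * S.lay hp f' = S.lay hp f' * S.lay hp f := by
  rw [← lay_add, ← lay_add, add_comm]

theorem lay_eq_one_iff (f : S.Fun) : S.lay hp f = 1 ↔ ∃ z, f = Function.const _ z := by
  have h : S.lay hp f = 1 ↔ S.nextMk hp 0 = S.nextMk hp ⟨f, 0⟩ :=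
    by
    rw [one_eq_zero]
    exact ⟨fun h => (congrArg AsymmetricProduct.fst h).symm, fun h =>
      AsymmetricProduct.ext h.symm rfl⟩
  rw [h, nextMk_eq_iff, sub_zero, mem_constSubgroup]
  simp

/-- The wreath action of `t` and the induced action of `s` combine into the single permutation `perm
e`. -/
theorem emb_mul_lay (e : S.Asym) (f : S.Fun) :
    S.emb hp e * S.lay hp f = S.lay hp (hatAut _ (S.perm e) f) * S.emb hp e := by
  ext1
  · change S.nextMk hp _ * (S.next hp).action _ (S.nextMk hp _) =
      S.nextMk hp _ * (S.next hp).action 1 (S.nextMk hp _)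
    rw [map_one, action_nextMk]
    change _ = S.nextMk hp _ * S.nextMk hp _
    rw [← nextMk_mul, ← nextMk_mul]
    refine congrArg (S.nextMk hp) (AsymmetricProduct.ext ?_ ?_)
    · change (0 : S.Fun) * wreathAction _ _ _ (hatAut _ _ f) =
        hatAut _ (S.perm e) f * wreathAction _ _ 0 0
      rw [map_zero, mul_zero']
      funext x
      exact zero_add _
    · change e.fst * S.action e.snd 0 = 0 * e.fst
      rw [map_zero, mul_zero', ← one_eq_zero, one_mul]
  · exact (mul_one _).trans (one_mul _).symm

theorem emb_conj_lay (e : S.Asym) (f : S.Fun) :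
    S.emb hp e * S.lay hp f * (S.emb hp e)⁻¹ = S.lay hp (hatAut _ (S.perm e) f) := by
  rw [emb_mul_lay, mul_inv_cancel_right]

theorem exists_eq_lay_mul_emb (x : (S.next hp).Asym) :
    ∃ f e, x = S.lay hp f * S.emb hp e := by
  obtain ⟨t, c⟩ := x
  obtain ⟨⟨f, g⟩, rfl⟩ := S.nextMk_surjective hp t
  refine ⟨f, ⟨g, c⟩, ?_⟩
  ext1
  · change _ = S.nextMk hp _ * (S.next hp).action 1 (S.nextMk hp _)
    rw [map_one]
    change _ = S.nextMk hp _ * S.nextMk hp _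
    rw [← nextMk_mul]
    refine congrArg (S.nextMk hp) (AsymmetricProduct.ext ?_ ?_)
    · change f = f * wreathAction _ _ 0 0
      rw [map_zero, mul_zero']
    · change g = 0 * g
      rw [← one_eq_zero, one_mul]
  · exact (one_mul _).symm

theorem lay_add_lay (f f' : S.Fun) :
    S.lay hp f + S.lay hp f' = ⟨0, TrivialBrace.val.symm (Pi.single k (functionForm f f'))⟩ +
      S.lay hp (f + f') := by
  ext1
  · change S.nextMk hp _ + S.nextMk hp _ = 0 + S.nextMk hp _
    rw [zero_add, ← nextMk_add]
    refine congrArg (S.nextMk hp) (AsymmetricProduct.ext ?_ ?_)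
    · rfl
    · exact (add_zero _).trans (add_zero _)
  · change (0 + 0 + (S.next hp).form (S.nextMk hp _) (S.nextMk hp _) : Factors p) =
      Pi.single k (functionForm f f') + 0 + (S.next hp).form 0 (S.nextMk hp _)
    rw [form_nextMk, wreathForm, form_zero_left, form_zero_left]
    simp

/-- With `F = lay f` and `F' = lay f'`, the element `(0, b(f, f'))` equals `F + F' - F' * F = F -
λ_{F'}(F)`, and both terms lie in the ideal. -/
theorem lay_form_mem {N : Subgroup (S.next hp).Asym} (hN : IsIdeal N) {f : S.Fun}
    (hf : S.lay hp f ∈ N) (f' : S.Fun) :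
    (⟨0, TrivialBrace.val.symm (Pi.single k (functionForm f f'))⟩ : (S.next hp).Asym) ∈ N := by
  rw [← add_sub_cancel_right (AsymmetricProduct.mk _ _) (S.lay hp (f + f')), ← lay_add_lay,
    add_comm f, lay_add, add_sub_assoc, ← neg_sub, ← lam]
  exact hN.add_mem hf (hN.neg_mem (hN.lam_mem _ _ hf))

/-- The projection from the asymmetric product of the next stage. -/
noncomputable def proj : (S.next hp).Asym →* S.Asym where
  toFun x := ⟨BraceQuotient.lift (constSubgroup_isIdeal (p k.succ) S.carrier)
    (fun w => w.snd) (fun w v h => by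
      have h2 : (v - w).snd = v.snd - w.snd := by
        simp [sub_eq_add_neg, semidirectDatum]
      exact (sub_eq_zero.1 (h2.symm.trans h.2)).symm) x.fst, x.snd⟩
  map_one' := rfl
  map_mul' x y := by
    obtain ⟨t, c⟩ := x
    obtain ⟨u, d⟩ := y
    obtain ⟨w, rfl⟩ := S.nextMk_surjective hp t
    obtain ⟨v, rfl⟩ := S.nextMk_surjective hp u
    rfl

theorem proj_lay (f : S.Fun) : S.proj hp (S.lay hp f) = 1 :=
  AsymmetricProduct.ext one_eq_zero.symm rfl

theorem proj_emb (e : S.Asym) : S.proj hp (S.emb hp e) = e := rfl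

theorem exists_lay_of_proj_eq_one {x : (S.next hp).Asym} (h : S.proj hp x = 1) :
    ∃ f, x = S.lay hp f := by
  obtain ⟨f, e, rfl⟩ := S.exists_eq_lay_mul_emb hp x
  rw [map_mul, proj_lay, proj_emb, one_mul] at h
  exact ⟨f, by rw [h, map_one, mul_one]⟩

end Next

end Stage

open scoped commutatorElement


namespace Stage

/-! ### Indicator functions, the radical of the form and invariance modulo constants -/

section Functions

variable {k : Fin m} (S : Stage p k.castSucc)

theorem card_nsmul_fun (f : S.Fun) : Fintype.card S.carrier • f = f :=
  funext fun x => S.card_nsmul k.castSucc_lt_succ (f x)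

theorem card_nsmul_val (z : TrivialBrace (ZMod (p k.succ))) : Fintype.card S.carrier • z = z :=
  congrFun (S.card_nsmul_fun (Function.const _ z)) 1

open scoped Classical in
/-- The indicator function of a point. -/
noncomputable def delta (y : S.carrier) : S.Fun :=
  fun x => if x = y then TrivialBrace.val.symm 1 else 0

theorem delta_self (y : S.carrier) : S.delta y y = TrivialBrace.val.symm 1 := if_pos rfl

theorem delta_of_ne {x y : S.carrier} (h : x ≠ y) : S.delta y x = 0 := if_neg h

open scoped Classical in
theorem hatAut_delta (e : Equiv.Perm S.carrier) (y : S.carrier) :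
    hatAut _ e (S.delta y) = S.delta (e y) := by
  funext x
  change S.delta y (e.symm x) = S.delta (e y) x
  exact if_congr e.symm_apply_eq rfl rfl

/-- A function whose difference with its image under a permutation is constant is invariant,
because the cardinality of the carrier is `1` modulo the prime. -/
theorem hatAut_eq_of_sub_const {e : Equiv.Perm S.carrier} {f : S.Fun}
    {z : TrivialBrace (ZMod (p k.succ))} (h : f - hatAut _ e f = Function.const _ z) :
    hatAut _ e f = f := by
  have hs : ∑ x, (f - hatAut _ e f) x = 0 := by
    have : ∑ x, f (e.symm x) = ∑ x, f x := Equiv.sum_comp e.symm f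
    simp only [Pi.sub_apply, Finset.sum_sub_distrib]
    exact sub_eq_zero.2 this.symm
  rw [h] at hs
  simp only [Function.const_apply, Finset.sum_const, Finset.card_univ, card_nsmul_val] at hs
  rw [hs] at h
  exact (sub_eq_zero.1 h).symm

theorem functionForm_delta_right (f : S.Fun) (y : S.carrier) :
    functionForm f (S.delta y) = augmentation f - TrivialBrace.val (f y) := by
  classical
  have h : ∀ x, TrivialBrace.val (S.delta y x) = if x = y then 1 else 0 := fun x => by
    by_cases hx : x = y
    · rw [hx, delta_self, if_pos rfl]; simp
    · rw [delta_of_ne _ hx, if_neg hx, map_zero]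
  simp [functionForm, augmentation, h]

/-- Pairing with the indicator of `y` gives `ε(f) - f(y)`, so every value of `f` is `ε(f)`. -/
theorem exists_const_of_functionForm_eq_zero {f : S.Fun} (h : ∀ f', functionForm f f' = 0) :
    ∃ z, f = Function.const _ z := by
  refine ⟨TrivialBrace.val.symm (augmentation f), funext fun y => ?_⟩
  have := h (S.delta y)
  rw [functionForm_delta_right, sub_eq_zero] at this
  rw [this]; simp

theorem functionForm_delta_delta {x y : S.carrier} (h : x ≠ y) :
    functionForm (S.delta x) (S.delta y) = 1 := by
  classical
  rw [functionForm_delta_right, S.delta_of_ne h.symm, map_zero, sub_zero, augmentation,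
    Finset.sum_eq_single x, delta_self]
  · simp
  · intro z _ hz
    rw [S.delta_of_ne hz, map_zero]
  · simp

variable (hp : IsPrimeChain p)
include hp

theorem delta_injective : Function.Injective S.delta := fun x y h => by
  have := Fact.mk (hp.prime k.succ)
  by_contra hxy
  have := congrFun h x
  rw [delta_self, S.delta_of_ne hxy] at this
  exact one_ne_zero (α := ZMod (p k.succ)) this

theorem perm_eq_of_delta_sub_const {e : Equiv.Perm S.carrier} {y : S.carrier}
    {z : TrivialBrace (ZMod (p k.succ))}
    (h : S.delta y - hatAut _ e (S.delta y) = Function.const _ z) : e y = y := by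
  have := S.hatAut_eq_of_sub_const h
  rw [hatAut_delta] at this
  exact S.delta_injective hp this

/-- A left translation whose square difference annihilates an indicator function modulo the
constants is trivial. -/
theorem eq_one_of_delta_sub_sub_const {g : S.carrier} {u : S.Fun}
    {z : TrivialBrace (ZMod (p k.succ))}
    (hu : u = S.delta 1 - hatAut _ (Equiv.mulLeft g) (S.delta 1))
    (h : u - hatAut _ (Equiv.mulLeft g) u = Function.const _ z) : g = 1 := by
  -- `u` is truly fixed by `g`, so translating by `g` repeatedly subtracts the same `u` from the
  -- indicator each time.
  have h1 := S.hatAut_eq_of_sub_const h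
  have h2 : ∀ j : ℕ, hatAut _ (Equiv.mulLeft (g ^ j)) (S.delta 1) = S.delta 1 - j • u := by
    intro j
    induction j with
    | zero =>
      rw [hatAut_delta]; simp
    | succ j ih =>
      have h3 : hatAut (TrivialBrace (ZMod (p k.succ))) (Equiv.mulLeft (g ^ (j + 1))) (S.delta 1) =
          hatAut _ (Equiv.mulLeft g) (hatAut _ (Equiv.mulLeft (g ^ j)) (S.delta 1)) := by
        simp only [hatAut_delta, Equiv.coe_mulLeft, pow_succ', mul_assoc]
      rw [h3, ih, map_sub, map_nsmul, h1, succ_nsmul, hu]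
      abel
  -- The exponent is the group order: `g ^ |G| = 1` while `|G| • u = u`, which forces `u = 0`.
  have h4 := h2 (Fintype.card S.carrier)
  rw [pow_card_eq_one, card_nsmul_fun, hatAut_delta, hu, hatAut_delta] at h4
  simp only [Equiv.coe_mulLeft, mul_one, sub_sub_cancel] at h4
  exact (S.delta_injective hp h4).symm

end Functions

/-! ### Growth of the derived series by one layer -/

section Derived

/-- The `d`-th derived subgroup of the asymmetric product meets the brace of the stage
nontrivially. -/
def MeetsDerived {i : Fin (m + 1)} (S : Stage p i) (d : ℕ) : Prop :=
  ∃ g : S.carrier, g ≠ 1 ∧ (⟨g, 1⟩ : S.Asym) ∈ derivedSeries S.Asym d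

variable {k : Fin m} (S : Stage p k.castSucc) (hp : IsPrimeChain p)

/-- Commutators realise the operator `1 - e` on the layer; the ideal and derived-series arguments
both rest on this. -/
theorem lay_sub_hatAut (e : S.Asym) (f : S.Fun) :
    ⁅S.lay hp f, S.emb hp e⁆ = S.lay hp (f - hatAut _ (S.perm e) f) := by
  rw [lay_sub, ← emb_conj_lay, commutatorElement_def]
  group

theorem lay_sub_hatAut_mem {N : Subgroup (S.next hp).Asym} (hN : N.Normal) {e : S.Asym}
    (he : S.emb hp e ∈ N) (f : S.Fun) : S.lay hp (f - hatAut _ (S.perm e) f) ∈ N := by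
  rw [← lay_sub_hatAut, commutatorElement_def]
  exact N.mul_mem (hN.conj_mem _ he _) (N.inv_mem he)

theorem perm_mk_one (g : S.carrier) : S.perm ⟨g, 1⟩ = Equiv.mulLeft g := by
  ext x
  rw [perm_apply, map_one]
  rfl

/-- One commutator with `(g, 1)` brings `(1 - g) δ₁` into the `d`-th derived subgroup by normality.
A second one, now between two of its elements, lands in the subgroup of index `d + 1`. -/
theorem MeetsDerived.next {d : ℕ} (h : S.MeetsDerived d) :
    (S.next hp).MeetsDerived (d + 1) := by
  obtain ⟨g, hg, hd⟩ := h
  have h1 : S.emb hp ⟨g, 1⟩ ∈ derivedSeries (S.next hp).Asym d :=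
    map_derivedSeries_le_derivedSeries (S.emb hp) d (Subgroup.mem_map_of_mem _ hd)
  have h2 := S.lay_sub_hatAut_mem hp (derivedSeries_normal _ _) h1 (S.delta 1)
  have h3 := Subgroup.commutator_mem_commutator h2 h1
  rw [lay_sub_hatAut, perm_mk_one, ← derivedSeries_succ] at h3
  refine ⟨_, fun h4 => hg ?_, h3⟩
  have h5 : S.lay hp _ = 1 := AsymmetricProduct.ext h4 rfl
  obtain ⟨z, hz⟩ := (S.lay_eq_one_iff hp _).1 h5
  exact S.eq_one_of_delta_sub_sub_const hp rfl hz

/-- The `d`-th derived subgroup dies under `proj`, so it lies in the commutative layer. -/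
theorem derivedSeries_next {d : ℕ} (h : derivedSeries S.Asym d = ⊥) :
    derivedSeries (S.next hp).Asym (d + 1) = ⊥ := by
  have h1 : ∀ x ∈ derivedSeries (S.next hp).Asym d, ∃ f, x = S.lay hp f := fun x hx => by
    have := map_derivedSeries_le_derivedSeries (S.proj hp) d (Subgroup.mem_map_of_mem _ hx)
    rw [h] at this
    exact S.exists_lay_of_proj_eq_one hp this
  rw [derivedSeries_succ, Subgroup.commutator_eq_bot_iff_le_centralizer]
  intro x hx
  rw [Subgroup.mem_centralizer_iff]
  intro y hy
  obtain ⟨f, rfl⟩ := h1 x hx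
  obtain ⟨f', rfl⟩ := h1 y hy
  exact S.lay_comm hp _ _

end Derived

/-! ### Ideals: propagation through the stages -/

section Ideals

/-- Every ideal containing a nonzero element of `A` contains the brace of the stage and the
coordinates of `A` that occur in the form. -/
def Absorbing {i : Fin (m + 1)} (S : Stage p i) : Prop :=
  ∀ N : Subgroup S.Asym, IsIdeal N → ∀ c : A p, c ≠ 0 → (⟨0, c⟩ : S.Asym) ∈ N →
    (∀ g, (⟨g, 0⟩ : S.Asym) ∈ N) ∧
      ∀ j : Fin m, j.castSucc < i → (⟨0, TrivialBrace.val.symm (Pi.single j 1)⟩ : S.Asym) ∈ N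

variable {k : Fin m} (S : Stage p k.castSucc) (hp : IsPrimeChain p)

theorem Faithful.next (hS : S.Faithful) : (S.next hp).Faithful := fun c hc =>
  hS c fun x => by
    have h := hc (S.nextMk hp ⟨0, x⟩)
    exact congrArg (fun t => (S.proj hp ⟨t, 0⟩).fst) h

include hp in
/-- Every function is, modulo the constants, a sum of differences `f - g f`. -/
theorem lay_mem_of_emb_mem {N : Subgroup (S.next hp).Asym} (hN : N.Normal)
    (h : ∀ g, S.emb hp ⟨g, 1⟩ ∈ N) (f : S.Fun) : S.lay hp f ∈ N := by
  let M : AddSubgroup S.Fun :=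
    { carrier := {f | S.lay hp f ∈ N}
      add_mem' := fun {a b} ha hb => by
        change S.lay hp (a + b) ∈ N
        rw [lay_add]; exact N.mul_mem ha hb
      zero_mem' := by
        change S.lay hp 0 ∈ N
        rw [lay_zero]; exact N.one_mem
      neg_mem' := fun {a} ha => by
        change S.lay hp (-a) ∈ N
        rw [lay_neg]; exact N.inv_mem ha }
  -- This sum is `|G| • f` minus the constant `∑ f`, and `|G| • f = f`.
  have hM : ∑ g : S.carrier, (f - hatAut _ (S.perm ⟨g, 1⟩) f) ∈ M :=
    M.sum_mem fun g _ => S.lay_sub_hatAut_mem hp hN (h g) f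
  have hc : ∑ g : S.carrier, hatAut _ (S.perm ⟨g, 1⟩) f = Function.const _ (∑ g, f g) := by
    funext x
    rw [Finset.sum_apply, Function.const_apply]
    simp only [perm_mk_one]
    exact Fintype.sum_equiv ((Equiv.inv S.carrier).trans (Equiv.mulRight x)) _ _ fun g => rfl
  have hk : Function.const _ (∑ g, f g) ∈ M := by
    change S.lay hp _ ∈ N
    rw [(S.lay_eq_one_iff hp _).2 ⟨_, rfl⟩]
    exact N.one_mem
  rw [Finset.sum_sub_distrib, hc, Finset.sum_const, Finset.card_univ, card_nsmul_fun] at hM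
  rw [← sub_add_cancel f (Function.const _ _)]
  exact M.add_mem hM hk

theorem Absorbing.next [Nontrivial S.carrier] (hS : S.Absorbing) : (S.next hp).Absorbing := by
  intro N hN c hc hcN
  obtain ⟨h1, h2⟩ := hS _ (S.isIdeal_comap hp hN) c hc hcN
  have h3 := S.lay_mem_of_emb_mem hp hN.normal h1
  refine ⟨fun g => ?_, fun j hj => ?_⟩
  · obtain ⟨f, ⟨g', c'⟩, h⟩ := S.exists_eq_lay_mul_emb hp ⟨g, 0⟩
    have hc' : c' = 0 := (one_mul c').symm.trans (congrArg AsymmetricProduct.snd h).symm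
    rw [h, hc']
    exact N.mul_mem (h3 f) (h1 g')
  -- Earlier coordinates come from the pulled-back ideal; the new one is the value `1` of the form
  -- at two distinct indicators.
  · rcases (Fin.castSucc_lt_succ_iff.1 hj).lt_or_eq with h | rfl
    · exact h2 j (Fin.castSucc_lt_castSucc_iff.2 h)
    · obtain ⟨x, y, hxy⟩ := exists_pair_ne S.carrier
      have := S.lay_form_mem hp hN (h3 (S.delta x)) (S.delta y)
      rwa [functionForm_delta_delta _ hxy] at this

/-- If the `emb` part of a nontrivial element is trivial, the element itself lies in the layer.
Otherwise it moves some `y`, and its commutator with the indicator of `y` is a nonconstant layer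
element. -/
theorem exists_lay_mem (hS : S.Faithful) {N : Subgroup (S.next hp).Asym} (hN : N.Normal)
    (h : N ≠ ⊥) : ∃ f, (¬ ∃ z, f = Function.const _ z) ∧ S.lay hp f ∈ N := by
  obtain ⟨x, hx, hx1⟩ := N.bot_or_exists_ne_one.resolve_left h
  obtain ⟨f, e, rfl⟩ := S.exists_eq_lay_mul_emb hp x
  by_cases he : ∀ y, S.perm e y = y
  · rw [hS.eq_one_of_perm he, map_one, mul_one] at hx hx1
    exact ⟨f, fun hf => hx1 ((S.lay_eq_one_iff hp f).2 hf), hx⟩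
  · obtain ⟨y, hy⟩ := not_forall.1 he
    refine ⟨_, fun ⟨z, hz⟩ => hy (S.perm_eq_of_delta_sub_const hp hz), ?_⟩
    have h1 : ⁅S.lay hp (S.delta y), S.lay hp f * S.emb hp e⁆ ∈ N := by
      rw [commutatorElement_def]
      exact N.mul_mem (hN.conj_mem _ hx _) (N.inv_mem hx)
    -- As the layer is abelian, the factor `lay f` only conjugates the commutator with `emb e`, and
    -- that conjugation is trivial.
    have h2 : ⁅S.lay hp (S.delta y), S.lay hp f * S.emb hp e⁆ =
        S.lay hp f * S.lay hp (S.delta y - hatAut _ (S.perm e) (S.delta y)) *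
          (S.lay hp f)⁻¹ := by
      rw [← lay_sub_hatAut, commutatorElement_def, commutatorElement_def, ← mul_assoc, lay_comm]
      group
    rw [h2, lay_comm, mul_inv_cancel_right] at h1
    exact h1

theorem exists_right_mem (hS : S.Faithful) {N : Subgroup (S.next hp).Asym} (hN : IsIdeal N)
    (h : N ≠ ⊥) : ∃ c : A p, c ≠ 0 ∧ (⟨0, c⟩ : (S.next hp).Asym) ∈ N := by
  obtain ⟨f, hf, hfN⟩ := S.exists_lay_mem hp hS hN.normal h
  obtain ⟨f', hf'⟩ : ∃ f', functionForm f f' ≠ 0 := by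
    by_contra! h
    exact hf (S.exists_const_of_functionForm_eq_zero h)
  exact ⟨_, fun h0 => hf' (Pi.single_eq_zero_iff (M := fun k : Fin m => ZMod (p k.succ)) |>.1 h0), S.lay_form_mem hp hN hfN f'⟩

theorem eq_top_of_mem {i : Fin (m + 1)} {S : Stage p i} {N : Subgroup S.Asym} (hN : IsIdeal N)
    (h1 : ∀ g, (⟨g, 0⟩ : S.Asym) ∈ N)
    (h2 : ∀ j : Fin m, (⟨0, TrivialBrace.val.symm (Pi.single j 1)⟩ : S.Asym) ∈ N) : N = ⊤ := by
  let M : AddSubgroup (Factors p) :=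
    { carrier := {c | (⟨0, TrivialBrace.val.symm c⟩ : S.Asym) ∈ N}
      add_mem' := fun {a b} ha hb => by
        have := hN.add_mem ha hb
        rwa [← right_add] at this
      zero_mem' := hN.zero_mem
      neg_mem' := fun {a} ha => by
        have := hN.neg_mem ha
        have h : -(⟨0, TrivialBrace.val.symm a⟩ : S.Asym) = ⟨0, TrivialBrace.val.symm (-a)⟩ := by
          rw [neg_eq_iff_add_eq_zero, ← right_add, ← map_add, add_neg_cancel]
          rfl
        rwa [h] at this }
  have hM : ∀ c, c ∈ M := fun c => by
    rw [← Finset.univ_sum_single c]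
    refine M.sum_mem fun j _ => ?_
    -- Each coordinate field is additively generated by `1`.
    obtain ⟨z, hz⟩ := ZMod.intCast_surjective (c j)
    have h : Pi.single j (c j) = z • (Pi.single j 1 : Factors p) := by
      rw [← Pi.single_smul, zsmul_one, hz]
    rw [h]
    exact M.zsmul_mem (h2 j) z
  rw [eq_top_iff]
  rintro ⟨g, c⟩ -
  rw [mk_eq_mul]
  exact N.mul_mem (h1 g) (hM c)

end Ideals

end Stage

/-- The unit group is cyclic of order `p 0 - 1`, which the product of the other primes divides since
they are pairwise coprime. -/
theorem IsPrimeChain.exists_orderOf_eq_prod (hp : IsPrimeChain p) :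
    ∃ γ : (ZMod (p 0))ˣ, orderOf γ = ∏ k : Fin m, p k.succ := by
  have := Fact.mk (hp.prime 0)
  obtain ⟨g, hg⟩ := IsCyclic.exists_ofOrder_eq_natCard (α := (ZMod (p 0))ˣ)
  rw [Nat.card_eq_fintype_card, ZMod.card_units] at hg
  have hd : ∏ k : Fin m, p k.succ ∣ p 0 - 1 :=
    Finset.prod_dvd_of_isRelPrime
      (fun a _ b _ hab => Nat.coprime_iff_isRelPrime.1 (hp.pairwise_coprime hab))
      fun k _ => hp.dvd 0 k.succ k.succ_pos
  rw [← hg] at hd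
  exact ⟨_, orderOf_pow_orderOf_div (orderOf_pos g).ne' hd⟩

/-! ### The base stage: a prime field with scalar action -/

section Base

variable (hp : IsPrimeChain p) {γ : (ZMod (p 0))ˣ} (hγ : orderOf γ = ∏ k : Fin m, p k.succ)

/-- A nonzero element of `A` acts on `𝔽_{p₁}` by a multiplication without nonzero fixed points. -/
theorem baseAction_eq_mul {c : A p} (hc : c ≠ 0) :
    ∃ u : ZMod (p 0), u ≠ 1 ∧ ∀ z : ZMod (p 0), baseAction hp hγ c z = u * z := by
  refine ⟨((γ ^ (hp.exists_zsmul c).choose : (ZMod (p 0))ˣ) : ZMod (p 0)), fun h => hc ?_,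
    fun z => rfl⟩
  have hi := (hp.exists_zsmul c).choose_spec
  -- If `γ ^ i = 1`, then every `p k.succ` divides `i`, so all coordinates of `c = i a` vanish.
  rw [Units.val_eq_one, ← orderOf_dvd_iff_zpow_eq_one, hγ] at h
  refine Eq.trans hi.symm (funext fun k => ?_)
  rw [zsmul_one]
  refine (ZMod.intCast_zmod_eq_zero_iff_dvd _ _).2 (dvd_trans ?_ h)
  exact Int.natCast_dvd_natCast.2 (Finset.dvd_prod_of_mem _ (Finset.mem_univ k))

theorem faithful_baseStage : (baseStage hp hγ).Faithful := fun c h => by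
  by_contra hc
  obtain ⟨u, hu, h2⟩ := baseAction_eq_mul hp hγ hc
  exact hu ((mul_one u).symm.trans ((h2 1).symm.trans (h (1 : ZMod (p 0)))))

theorem nontrivial_baseStage : Nontrivial (baseStage hp hγ).carrier :=
  have := Fact.mk (hp.prime 0)
  inferInstanceAs (Nontrivial (ZMod (p 0)))

/-- The commutators of `(z, 0)` and `(0, c)`. -/
theorem commutator_baseStage {c : A p} {u : ZMod (p 0)}
    (hu : ∀ z : ZMod (p 0), baseAction hp hγ c z = u * z) (z : ZMod (p 0)) :
    ⁅(⟨z, 0⟩ : (baseStage hp hγ).Asym), (⟨0, c⟩ : (baseStage hp hγ).Asym)⁆ =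
      (⟨(z - u * z : ZMod (p 0)), 0⟩ : (baseStage hp hγ).Asym) := by
  have h0 : ∀ d : A p, baseAction hp hγ d (0 : ZMod (p 0)) = (0 : ZMod (p 0)) := fun d =>
    map_zero (baseAction hp hγ d)
  have h1 : baseAction hp hγ (0 + c) z = u * z := by rw [zero_add, hu]
  rw [commutatorElement_def, mul_inv_eq_iff_eq_mul, mul_inv_eq_iff_eq_mul]
  ext1
  · refine Eq.trans (congrArg (fun w : ZMod (p 0) => z + w) (h0 0)) (Eq.trans ?_
      (congrArg₂ (fun v w : ZMod (p 0) => z - u * z + v + w) (h0 0) h1).symm)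
    change z + 0 = z - u * z + 0 + u * z
    rw [add_zero, add_zero, sub_add_cancel]
  · change (0 + c : A p) = 0 + c + 0
    rw [add_zero]

theorem absorbing_baseStage : (baseStage hp hγ).Absorbing := by
  intro N hN c hc hcN
  have := Fact.mk (hp.prime 0)
  obtain ⟨u, hu, h2⟩ := baseAction_eq_mul hp hγ hc
  refine ⟨fun (g : ZMod (p 0)) => ?_, fun j hj => absurd hj (Fin.not_lt_zero _)⟩
  -- The commutator with `(0, c)` multiplies by `1 - u`, so dividing beforehand makes it exactly
  -- `g`.
  have h1 : ⁅(⟨((1 - u)⁻¹ * g : ZMod (p 0)), 0⟩ : (baseStage hp hγ).Asym),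
      (⟨0, c⟩ : (baseStage hp hγ).Asym)⁆ ∈ N := by
    rw [commutatorElement_def]
    exact N.mul_mem (hN.normal.conj_mem _ hcN _) (N.inv_mem hcN)
  rw [commutator_baseStage hp hγ h2] at h1
  have h3 : (1 - u)⁻¹ * g - u * ((1 - u)⁻¹ * g) = g := by
    rw [← one_sub_mul, mul_inv_cancel_left₀ (sub_ne_zero.2 hu.symm)]
  rwa [h3] at h1

/-- For `m ≥ 1` the brace `A` is nonzero and acts by some scalar `u ≠ 1`; the commutator with `1` is
then `1 - u`. -/
theorem meetsDerived_baseStage (hm : 1 ≤ m) : (baseStage hp hγ).MeetsDerived 1 := by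
  have := Fact.mk (hp.prime 0)
  have hm' : (Pi.single ⟨0, hm⟩ 1 : Factors p) ≠ 0 := fun h => by
    have := Fact.mk (hp.prime (Fin.succ ⟨0, hm⟩))
    exact one_ne_zero (Pi.single_eq_zero_iff.1 h)
  obtain ⟨u, hu, h2⟩ := baseAction_eq_mul hp hγ 
    (c := TrivialBrace.val.symm (Pi.single ⟨0, hm⟩ 1)) hm'
  refine ⟨(1 - u : ZMod (p 0)), sub_ne_zero.2 hu.symm, ?_⟩
  rw [derivedSeries_one]
  have h3 := Subgroup.commutator_mem_commutator
    (Subgroup.mem_top (⟨(1 : ZMod (p 0)), 0⟩ : (baseStage hp hγ).Asym))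
    (Subgroup.mem_top ⟨0, TrivialBrace.val.symm (Pi.single ⟨0, hm⟩ 1)⟩)
  rw [commutator_baseStage hp hγ h2, mul_one] at h3
  exact h3

/-- Projection to the commutative `A` confines the first derived subgroup to the prime field, which
is itself commutative. -/
theorem derivedSeries_baseStage : derivedSeries (baseStage hp hγ).Asym 2 = ⊥ := by
  have h1 : ∀ x ∈ derivedSeries (baseStage hp hγ).Asym 1, x.snd = 0 := fun x hx => by
    let φ : (baseStage hp hγ).Asym →* A p :=
      { toFun := AsymmetricProduct.snd
        map_one' := rfl
        map_mul' := fun _ _ => rfl }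
    have h := map_derivedSeries_le_derivedSeries φ 1 (Subgroup.mem_map_of_mem φ hx)
    have h2 : derivedSeries (A p) 1 = ⊥ := by
      rw [derivedSeries_one, commutator_def, Subgroup.commutator_eq_bot_iff_le_centralizer]
      intro x _
      rw [Subgroup.mem_centralizer_iff]
      exact fun y _ => TrivialBrace.mul_comm' y x
    rw [h2] at h
    exact h
  rw [derivedSeries_succ, Subgroup.commutator_eq_bot_iff_le_centralizer]
  intro x hx
  rw [Subgroup.mem_centralizer_iff]
  intro y hy
  have hx := h1 x hx
  have hy := h1 y hy
  ext1
  · change y.fst * (baseStage hp hγ).action y.snd x.fst =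
      x.fst * (baseStage hp hγ).action x.snd y.fst
    rw [hx, hy, ← one_eq_zero, map_one]
    exact TrivialBrace.mul_comm' (A := ZMod (p 0)) _ _
  · exact TrivialBrace.mul_comm' _ _

end Base

/-! ### Induction over the stages and conclusion -/

section Stages

variable (hp : IsPrimeChain p) {γ : (ZMod (p 0))ˣ} (hγ : orderOf γ = ∏ k : Fin m, p k.succ)

theorem stage_succ (k : Fin m) :
    stage hp hγ k.succ = (stage hp hγ k.castSucc).next hp :=
  Fin.induction_succ _ _ _

theorem Stage.nontrivial_next {k : Fin m} (S : Stage p k.castSucc) (hS : Nontrivial S.carrier) :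
    Nontrivial (S.next hp).carrier := by
  obtain ⟨x, y, hxy⟩ := exists_pair_ne S.carrier
  refine ⟨S.nextMk hp ⟨0, x⟩, S.nextMk hp ⟨0, y⟩, fun h => hxy ?_⟩
  have := congrArg (fun t => (S.proj hp ⟨t, 0⟩).fst) h
  exact this

theorem nontrivial_stage (i : Fin (m + 1)) : Nontrivial (stage hp hγ i).carrier := by
  induction i using Fin.induction with
  | zero => exact nontrivial_baseStage hp hγ
  | succ k ih => rw [stage_succ]; exact Stage.nontrivial_next hp _ ih

theorem faithful_stage (i : Fin (m + 1)) : (stage hp hγ i).Faithful := by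
  induction i using Fin.induction with
  | zero => exact faithful_baseStage hp hγ
  | succ k ih => rw [stage_succ]; exact Stage.Faithful.next _ hp ih

theorem absorbing_stage (i : Fin (m + 1)) : (stage hp hγ i).Absorbing := by
  induction i using Fin.induction with
  | zero => exact absorbing_baseStage hp hγ
  | succ k ih =>
    have := nontrivial_stage hp hγ k.castSucc
    rw [stage_succ]; exact Stage.Absorbing.next _ hp ih

theorem meetsDerived_stage (hm : 1 ≤ m) (i : Fin (m + 1)) :
    (stage hp hγ i).MeetsDerived (i + 1) := by
  induction i using Fin.induction with
  | zero => exact meetsDerived_baseStage hp hγ hm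
  | succ k ih => rw [stage_succ]; exact Stage.MeetsDerived.next _ hp ih

theorem derivedSeries_stage (i : Fin (m + 1)) :
    derivedSeries (stage hp hγ i).Asym (i + 1 + 1) = ⊥ := by
  induction i using Fin.induction with
  | zero => exact derivedSeries_baseStage hp hγ
  | succ k ih => rw [stage_succ]; exact Stage.derivedSeries_next _ hp ih

/-- Since `k` is the last index, the coordinates provided by `Absorbing` exhaust `A`. -/
theorem Stage.isSimple_next {k : Fin m} {S : Stage p k.castSucc} (hS : S.Faithful)
    (hA : (S.next hp).Absorbing) (hN : Nontrivial (S.next hp).carrier)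
    (hk : ∀ j : Fin m, j ≤ k) : LeftBrace.IsSimple (S.next hp).Asym := by
  refine ⟨?_, fun N hI => or_iff_not_imp_left.2 fun hbot => ?_⟩
  · obtain ⟨x, y, hxy⟩ := hN
    exact ⟨⟨x, 0⟩, ⟨y, 0⟩, fun h => hxy (congrArg AsymmetricProduct.fst h)⟩
  · obtain ⟨c, hc, hcN⟩ := S.exists_right_mem hp hS hI hbot
    obtain ⟨h1, h2⟩ := hA N hI c hc hcN
    exact Stage.eq_top_of_mem hI h1 fun j => h2 j (Fin.castSucc_lt_succ_iff.2 (hk j))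

theorem isSimple_stage_succ {k : Fin m} (hk : ∀ j : Fin m, j ≤ k) :
    LeftBrace.IsSimple (stage hp hγ k.succ).Asym := by
  have hA := absorbing_stage hp hγ k.succ
  have hN := nontrivial_stage hp hγ k.succ
  rw [stage_succ] at hA hN ⊢
  exact Stage.isSimple_next hp (faithful_stage hp hγ _) hA hN hk

theorem isSimple_simpleBrace (hm : 1 ≤ m) : LeftBrace.IsSimple (SimpleBrace hp hγ) := by
  obtain ⟨m, rfl⟩ := Nat.exists_eq_add_of_le' hm
  -- `mainDatum` unfolds to the `datum` of the last stage, which is a successor stage because `m`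
  -- has been rewritten as `m + 1`.
  exact isSimple_stage_succ hp hγ (k := Fin.last m) Fin.le_last

end Stages

theorem mainTheorem2 (m : ℕ) (hm : 1 ≤ m) (p : Fin (m + 1) → ℕ) (hp : IsPrimeChain p) :
    (∃ γ : (ZMod (p 0))ˣ, orderOf γ = ∏ k : Fin m, p k.succ) ∧
    ∀ (γ : (ZMod (p 0))ˣ) (hγ : orderOf γ = ∏ k : Fin m, p k.succ),
      Finite (SimpleBrace hp hγ) ∧
      LeftBrace.IsSimple (SimpleBrace hp hγ) ∧
      Group.IsSolvable (SimpleBrace hp hγ) ∧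
      HasDerivedLength (SimpleBrace hp hγ) ((m + 1) + 1) := by
  refine ⟨hp.exists_orderOf_eq_prod, fun γ hγ => ?_⟩
  have hbot : derivedSeries (SimpleBrace hp hγ) (m + 1 + 1) = ⊥ :=
    derivedSeries_stage hp hγ (Fin.last m)
  refine ⟨?_, isSimple_simpleBrace hp hγ hm, ⟨⟨_, hbot⟩⟩, hbot, fun k hk h => ?_⟩
  · have : Finite (A p) := by
      have : ∀ k : Fin m, NeZero (p k.succ) := fun k => ⟨(hp.prime _).ne_zero⟩
      exact inferInstanceAs (Finite (Factors p))
    infer_instance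
  · obtain ⟨g, hg, hd⟩ : (stage hp hγ (Fin.last m)).MeetsDerived (m + 1) :=
      meetsDerived_stage hp hγ hm (Fin.last m)
    -- Nontriviality of the derived subgroup of index `m + 1` suffices, as it is contained in all
    -- the earlier ones.
    have hd := derivedSeries_antitone (SimpleBrace hp hγ) (Nat.lt_succ_iff.1 hk) hd
    rw [h] at hd
    exact hg (congrArg AsymmetricProduct.fst (Subgroup.mem_bot.1 hd))
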